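/- Let $\mathbf k$ be a field of characteristic $0$ with pairwise commuting derivations $\delta_1,\dots,\delta_m$, let $\Theta$ be the monoid of operators $\theta=\delta_1^{k_1}\cdots\delta_m^{k_m}$, and let $\mathbf k\{Y\}=\mathbf k\{y_1,\dots,y_n\}$ be the differential polynomial ring, i.e. the polynomial ring over $\mathbf k$ in the derivatives $\theta y_i$ (of order $k_1+\dots+k_m$), on which $\delta_1,\dots,\delta_m$ act naturally. Fix a ranking, i.e. a total order on the derivatives such that $\theta u\ge u$, and $u\ge v$ implies $\theta u\ge\theta v$. For $f\in\mathbf k\{Y\}\setminus\mathbf k$ let $\mathrm{ld} f$ be the highest derivative occurring in $f$ (its leader), let the initial of $f$ be the leading coefficient of $f$ as a polynomial in $\mathrm{ld} f$, and let the separant be $s_f=\partial f/\partial\,\mathrm{ld} f$. A polynomial is partially reduced w.r.t. $f$ if it contains no proper derivative of $\mathrm{ld} f$, and reduced w.r.t. $f$ if moreover its degree in $\mathrm{ld} f$ is less than that of $f$. A set $\mathbb C\subset\mathbf k\{Y\}\setminus\mathbf k$ is d-triangular if for all distinct $f,g\in\mathbb C$ the leader of $f$ is not a derivative of the leader of $g$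 (nor equal to it), and $f$ is partially reduced w.r.t. $g$. Let $H_{\mathbb C}$ be the set of initials and separants of elements of $\mathbb C$, let $H_{\mathbb C}^\infty$ be the multiplicative monoid generated by $H_{\mathbb C}$, and for an ideal $I$ let $I:H_{\mathbb C}^\infty=\{a:\ sa\in I\text{ for some }s\in H_{\mathbb C}^\infty\}$. Let $(\mathbb C)$ and $[\mathbb C]$ be the ideal and the differential ideal generated by $\mathbb C$. The set $\mathbb C$ is coherent if, for all distinct $f,g\in\mathbb C$ whose leaders have a common derivative, with $v=\theta\,\mathrm{ld} f=\theta'\,\mathrm{ld} g$ the lowest one, $s_g\,\theta f-s_f\,\theta' g\in(\phi c:\ c\in\mathbb C,\ \phi\in\Theta,\ \phi\,\mathrm{ld} c<v):H_{\mathbb C}^\infty$. A differential remainder of $f$ w.r.t. $\mathbb C$ is a $g$ that is reduced w.r.t. every element of $\mathbb C$ and satisfies $hf-g\in[\mathbb C]:H_{\mathbb C}^\infty$ for some $h\in H_{\mathbb C}^\infty$. Let $m_i(\mathbb C)$ be the maximal order of a derivative of $y_i$ occurring in $\mathbb C$ ($0$ if there is none). Let $\mathbb C$ be a coherent d-triangular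 set and $f\in\mathbf k\{Y\}$. (1) Let $g,\bar g$ be differential remainders of $f$ w.r.t. $\mathbb C$, and let $X$ be the set of derivatives occurring in $\mathbb C$ and $g$. If $u\notin X$ is a derivative and $\bar g=a_ku^k+\dots+a_0$ with $a_0,\dots,a_k$ free of $u$, then $\bar g-a_0\in(\mathbb C):H_{\mathbb C}^\infty$, and $a_0$ is also a differential remainder of $f$ w.r.t. $\mathbb C$. Likewise, if $\bar g_X$ is the sum of the terms of $\bar g$ that belong to $\mathbf k[X]$, then $\bar g-\bar g_X\in(\mathbb C):H_{\mathbb C}^\infty$, and $\bar g_X$ is a differential remainder of $f$ w.r.t. $\mathbb C$. (2) Let $p_i\ge m_i(\mathbb C)$, $i=1,\dots,n$, be integers, and assume that there exists a differential remainder of $f$ w.r.t. $\mathbb C$ that contains no derivative of $y_i$ of order greater than $p_i$, $i=1,\dots,n$. Let $g$ be any differential remainder of $f$ w.r.t. $\mathbb C$. Then the truncation of $g$, i.e. the sum of those terms of $g$ in which every derivative of each $y_i$ that occurs has order at most $p_i$, is a differential remainder of $f$ w.r.t. $\mathbb C$, in which the order of every $y_i$ does not exceed $p_i$. -/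

import Mathlib

open MvPolynomial

noncomputable section

/-- A derivative `θ y_i`: `op` is the exponent vector of the derivative operator
`θ = δ_1^{k_1} ⋯ δ_m^{k_m}` and `var` is the index `i` of the differential indeterminate. -/
@[ext]
structure Deriv (m n : ℕ) where
  op : Fin m →₀ ℕ
  var : Fin n

namespace Deriv

variable {m n : ℕ}

/-- The action `θ₁ (θ₂ y_i) = (θ₁ θ₂) y_i` of derivative operators on derivatives. -/
def shift (θ : Fin m →₀ ℕ) (u : Deriv m n) : Deriv m n := ⟨θ + u.op, u.var⟩

/-- The order `k_1 + ⋯ + k_m` of a derivative. -/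
def ord (u : Deriv m n) : ℕ := ∑ j, u.op j

/-- `v` is a derivative (possibly the trivial one) of `u`. -/
def IsDerivOf (v u : Deriv m n) : Prop := ∃ θ, v = shift θ u

/-- `v` is a proper derivative of `u`. -/
def IsProperDerivOf (v u : Deriv m n) : Prop := ∃ θ, θ ≠ 0 ∧ v = shift θ u

end Deriv

/-- The given total order on the set of derivatives is a ranking. -/
structure IsRanking (m n : ℕ) [LinearOrder (Deriv m n)] : Prop where
  le_shift : ∀ (θ : Fin m →₀ ℕ) (u : Deriv m n), u ≤ Deriv.shift θ u
  shift_mono : ∀ (θ : Fin m →₀ ℕ) (u v : Deriv m n), v ≤ u → Deriv.shift θ v ≤ Deriv.shift θ u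

/-- The ring `k{y_1, …, y_n}` of differential polynomials (for `m` derivations): commutative
polynomials over `k` in the derivatives. -/
abbrev DiffPoly (m n : ℕ) (k : Type*) [Field k] := MvPolynomial (Deriv m n) k

namespace DiffPoly

variable {m n : ℕ} {k : Type*} [Field k]

/-- Application of a derivation of `k` to all the coefficients. -/
def mapCoeff (d : Derivation ℤ k k) (f : DiffPoly m n k) : DiffPoly m n k :=
  ∑ s ∈ f.support, monomial s (d (coeff s f))

theorem coeff_mapCoeff (d : Derivation ℤ k k) (f : DiffPoly m n k) (s : Deriv m n →₀ ℕ) :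
    coeff s (mapCoeff d f) = d (coeff s f) := by
  classical
  unfold mapCoeff
  rw [coeff_sum]
  simp only [coeff_monomial]
  rw [Finset.sum_ite_eq']
  split_ifs with h
  · rfl
  · rw [notMem_support_iff.mp h, map_zero]

/-- `mapCoeff` as a derivation of the polynomial ring. -/
def coeffDerivation (d : Derivation ℤ k k) :
    Derivation ℤ (DiffPoly m n k) (DiffPoly m n k) :=
  Derivation.mk'
    (AddMonoidHom.toIntLinearMap
      { toFun := mapCoeff d
        map_zero' := by ext s; simp [coeff_mapCoeff]
        map_add' := fun f g => by ext s; simp [coeff_mapCoeff] })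
    (fun f g => by
      classical
      ext s
      change coeff s (mapCoeff d (f * g)) = coeff s (f * mapCoeff d g + g * mapCoeff d f)
      rw [mul_comm g, coeff_add, coeff_mapCoeff, coeff_mul, coeff_mul, coeff_mul, map_sum,
        ← Finset.sum_add_distrib]
      refine Finset.sum_congr rfl fun x _ => ?_
      rw [Derivation.leibniz, coeff_mapCoeff, coeff_mapCoeff, smul_eq_mul, smul_eq_mul]
      ring)

/-- The extension of the derivation `δ_j` of `k` to differential polynomials: it acts on
coefficients by `δ_j` and maps the derivative `θ y_i` to `(δ_j θ) y_i`. -/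
def deriv (δ : Fin m → Derivation ℤ k k) (j : Fin m) :
    Derivation ℤ (DiffPoly m n k) (DiffPoly m n k) :=
  coeffDerivation (δ j) +
    (mkDerivation k fun u : Deriv m n =>
      (X (Deriv.shift (Finsupp.single j 1) u) : DiffPoly m n k)).restrictScalars ℤ

/-- The action of the derivative operator `θ = δ_1^{θ 1} ⋯ δ_m^{θ m}`. -/
def applyOp (δ : Fin m → Derivation ℤ k k) (θ : Fin m →₀ ℕ) (f : DiffPoly m n k) :
    DiffPoly m n k :=
  (List.finRange m).foldr (fun j g => (deriv δ j)^[θ j] g) f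

/-- `[F]`: the smallest ideal that contains `F` and is closed under the derivations. -/
def diffIdeal (δ : Fin m → Derivation ℤ k k) (F : Set (DiffPoly m n k)) :
    Ideal (DiffPoly m n k) :=
  sInf {I | F ⊆ I ∧ ∀ j, ∀ f ∈ I, deriv δ j f ∈ I}

/-- The saturation `I : S^∞`, where `S^∞` is the multiplicative set generated by `S`
(it contains `1`). -/
def sat {R : Type*} [CommRing R] (I : Ideal R) (S : Set R) : Ideal R where
  carrier := {a | ∃ s ∈ Submonoid.closure S, s * a ∈ I}
  zero_mem' := ⟨1, one_mem _, by simp⟩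
  add_mem' := by
    rintro a b ⟨s, hs, ha⟩ ⟨t, ht, hb⟩
    refine ⟨s * t, mul_mem hs ht, ?_⟩
    have h : s * t * (a + b) = t * (s * a) + s * (t * b) := by ring
    rw [h]
    exact I.add_mem (I.mul_mem_left _ ha) (I.mul_mem_left _ hb)
  smul_mem' := by
    rintro c a ⟨s, hs, ha⟩
    refine ⟨s, hs, ?_⟩
    have h : s * (c • a) = c * (s * a) := by rw [smul_eq_mul]; ring
    rw [h]
    exact I.mul_mem_left _ ha

/-- The sum of those terms of `f` in which only derivatives from `P` occur, that is, of the
terms of `f` that belong to `k[P]`. -/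
def restrictTo (P : Set (Deriv m n)) (f : DiffPoly m n k) : DiffPoly m n k :=
  open Classical in
  ∑ s ∈ f.support.filter (fun s => (s.support : Set (Deriv m n)) ⊆ P), monomial s (coeff s f)

/-- The truncation of `f`: the sum of those terms of `f` in which only derivatives of
each `y_i` of order at most `p i` occur. -/
def truncate (p : Fin n → ℕ) (f : DiffPoly m n k) : DiffPoly m n k :=
  restrictTo {u | u.ord ≤ p u.var} f

/-- `m_i(F)`: the maximal order of a derivative of `y_i` occurring in `F`
(`0` if `y_i` does not occur in `F`, and `⊤` if the orders are unbounded). -/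
def maxOrder (i : Fin n) (F : Set (DiffPoly m n k)) : ℕ∞ :=
  ⨆ f ∈ F, ⨆ u ∈ f.vars, ⨆ _ : u.var = i, (u.ord : ℕ∞)

/-- The set of derivatives occurring in elements of `F`. -/
def derivativesIn (F : Set (DiffPoly m n k)) : Set (Deriv m n) :=
  {u | ∃ f ∈ F, u ∈ f.vars}

/-- The coefficient of `u ^ d` in `f`, viewed as a univariate polynomial in `u`. -/
def coeffIn (u : Deriv m n) (d : ℕ) (f : DiffPoly m n k) : DiffPoly m n k :=
  ∑ s ∈ f.support.filter (fun s => s u = d), monomial (s.erase u) (coeff s f)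

/-- The initial of a differential polynomial with leader `u`. -/
def initialAt (u : Deriv m n) (f : DiffPoly m n k) : DiffPoly m n k :=
  coeffIn u (degreeOf u f) f

/-- The separant of a differential polynomial with leader `u`. -/
def separantAt (u : Deriv m n) (f : DiffPoly m n k) : DiffPoly m n k :=
  pderiv u f

section Ranked

variable [LinearOrder (Deriv m n)]

/-- `u` is the leader of `f`: the derivative of highest rank that occurs in `f`. -/
def IsLeader (u : Deriv m n) (f : DiffPoly m n k) : Prop :=
  u ∈ f.vars ∧ ∀ v ∈ f.vars, v ≤ u

/-- `f` is partially reduced with respect to `g`. -/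
def PartiallyReduced (f g : DiffPoly m n k) : Prop :=
  ∀ u, IsLeader u g → ∀ v ∈ f.vars, ¬ v.IsProperDerivOf u

/-- `f` is reduced with respect to `g`. -/
def Reduced (f g : DiffPoly m n k) : Prop :=
  PartiallyReduced f g ∧ ∀ u, IsLeader u g → degreeOf u f < degreeOf u g

/-- `H_C`: the set of initials and separants of the elements of `C`. -/
def initSep (C : Set (DiffPoly m n k)) : Set (DiffPoly m n k) :=
  {h | ∃ f ∈ C, ∃ u, IsLeader u f ∧ (h = initialAt u f ∨ h = separantAt u f)}

/-- `C` is a d-triangular set: its elements are not in `k`, the leader of an element is never a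
derivative (not even the trivial one) of the leader of another element, and the elements are
pairwise partially reduced. -/
structure IsDTriangular (C : Set (DiffPoly m n k)) : Prop where
  not_const : ∀ f ∈ C, ∀ c : k, f ≠ MvPolynomial.C c
  leaders : ∀ f ∈ C, ∀ g ∈ C, f ≠ g → ∀ u v, IsLeader u f → IsLeader v g → ¬ u.IsDerivOf v
  partially : ∀ f ∈ C, ∀ g ∈ C, f ≠ g → PartiallyReduced f g

/-- The set of all `θ f`, with `f ∈ C` and `θ` a derivative operator, such that
`θ (ld f)` is lower than `v`. -/
def prolongBelow (δ : Fin m → Derivation ℤ k k) (C : Set (DiffPoly m n k)) (v : Deriv m n) :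
    Set (DiffPoly m n k) :=
  {q | ∃ f ∈ C, ∃ u θ, IsLeader u f ∧ Deriv.shift θ u < v ∧ q = applyOp δ θ f}

/-- Coherence: whenever the leaders `u`, `w` of two distinct elements `f`, `g` of `C` have a
common derivative, with `v = θ u = θ' w` the lowest one, the polynomial `s_g (θ f) - s_f (θ' g)`
lies in `(ΘC_{<v}) : H_C^∞`. -/
def IsCoherent (δ : Fin m → Derivation ℤ k k) (C : Set (DiffPoly m n k)) : Prop :=
  ∀ f ∈ C, ∀ g ∈ C, f ≠ g → ∀ u w, IsLeader u f → IsLeader w g → u.var = w.var →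
    separantAt w g * applyOp δ (u.op ⊔ w.op - u.op) f -
        separantAt u f * applyOp δ (u.op ⊔ w.op - w.op) g ∈
      sat (Ideal.span (prolongBelow δ C ⟨u.op ⊔ w.op, u.var⟩)) (initSep C)

/-- `g` is a differential remainder of `f` with respect to `C`: it is reduced with respect to
every element of `C`, and `h f - g ∈ [C] : H_C^∞` for some `h ∈ H_C^∞`. -/
def IsDiffRemainder (δ : Fin m → Derivation ℤ k k) (C : Set (DiffPoly m n k))
    (f g : DiffPoly m n k) : Prop :=
  (∀ c ∈ C, Reduced g c) ∧
    ∃ h ∈ Submonoid.closure (initSep C), h * f - g ∈ sat (diffIdeal δ C) (initSep C)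

end Ranked

end DiffPoly

end

/-!
By Rosenfeld's lemma, a polynomial of `[C] : H_C^∞` that is partially reduced with respect to all of
`C` lies in `(C) : H_C^∞`. Its proof removes the prolongations `θ c` one derivative `v` at a time,
from the top down. If `v` is a proper derivative of some leader, coherence makes all prolongations
with leader `v` proportional, up to multipliers in `H_C^∞` and modulo lower prolongations. One
prolongation `q = s X_v + r` then remains, and it disappears under the substitution `X_v = -r / s`,
which leaves polynomials free of `v` unchanged. A ranking is a well-order, so the process stops.

If `g` and `g'` are differential remainders of `f` with multipliers `h` and `h'`, then `h g' - h' g`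
is partially reduced, hence lies in `(C) : H_C^∞`. When `C` and `g` involve only derivatives from
`P`, the `k[P]`-linear projection of `k{Y}` onto `k[P]` preserves `(C) : H_C^∞`. Subtracting the
projection of `h g' - h' g` from it leaves `h (g' - g'_P) ∈ (C) : H_C^∞`.
-/

section Derivation

variable {R A : Type*} [CommRing R] [CommRing A] [Algebra R A]

theorem derivation_mem_of_mem_adjoin {R₀ : Type*} [CommRing R₀] [Algebra R₀ A]
    (D : Derivation R₀ A A) {s : Set A} {B : Subalgebra R A} (hs : s ⊆ B)
    (hD : ∀ x ∈ s, D x ∈ B) (hR : ∀ r, D (algebraMap R A r) ∈ B) {a : A}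
    (ha : a ∈ Algebra.adjoin R s) : D a ∈ B := by
  have hle : Algebra.adjoin R s ≤ B := Algebra.adjoin_le hs
  induction ha using Algebra.adjoin_induction with
  | mem x hx => exact hD x hx
  | algebraMap r => exact hR r
  | add x y _ _ hx hy => rw [map_add]; exact add_mem hx hy
  | mul x y hx hy hDx hDy =>
    rw [D.leibniz, smul_eq_mul, smul_eq_mul]
    exact add_mem (mul_mem (hle hx) hDy) (mul_mem (hle hy) hDx)

theorem derivation_mem_of_mem_span (D : Derivation R A A) {G : Set A} {J : Ideal A} (hG : G ⊆ J)
    (hD : ∀ x ∈ G, D x ∈ J) {a : A} (ha : a ∈ Ideal.span G) : D a ∈ J := by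
  induction ha using Submodule.span_induction with
  | mem x hx => exact hD x hx
  | zero => rw [map_zero]; exact J.zero_mem
  | add x y _ _ hx hy => rw [map_add]; exact J.add_mem hx hy
  | smul r x hx hDx =>
    rw [smul_eq_mul, D.leibniz, smul_eq_mul, smul_eq_mul]
    exact J.add_mem (J.mul_mem_left _ hDx) (J.mul_mem_right _ (Ideal.span_le.2 hG hx))

theorem mul_derivation_sub_mul_derivation_mem (D : Derivation R A A) {J : Ideal A} {a b x y : A}
    (hx : x ∈ J) (hy : y ∈ J) (h : D (a * x - b * y) ∈ J) : a * D x - b * D y ∈ J := by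
  have hleibniz : a * D x - b * D y = D (a * x - b * y) - (D a * x - D b * y) := by
    simp only [map_sub, D.leibniz, smul_eq_mul]
    ring
  rw [hleibniz]
  exact J.sub_mem h (J.sub_mem (J.mul_mem_left _ hx) (J.mul_mem_left _ hy))

end Derivation

section Polynomial

variable {σ R : Type*} [CommRing R]

theorem mem_supported_iff_forall_mem_support {S : Set σ} {f : MvPolynomial σ R} :
    f ∈ supported R S ↔ ∀ s ∈ f.support, (s.support : Set σ) ⊆ S := by
  simp only [mem_supported, Set.subset_def, Finset.mem_coe, mem_vars_iff_mem_support]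
  exact ⟨fun h s hs u hu => h u ⟨s, hs, hu⟩, fun h u ⟨s, hs, hu⟩ => h s hs u hu⟩

theorem support_sum_monomial_subset (T : Finset (σ →₀ ℕ)) (a : (σ →₀ ℕ) → R) :
    (∑ s ∈ T, monomial s (a s)).support ⊆ T := by
  classical
  exact support_sum.trans <| Finset.biUnion_subset.2 fun s hs =>
    support_monomial_subset.trans (Finset.singleton_subset_iff.2 hs)

theorem pderiv_mem_supported (u : σ) {S : Set σ} {f : MvPolynomial σ R}
    (hf : f ∈ supported R S) : pderiv u f ∈ supported R S := by
  classical
  refine derivation_mem_of_mem_adjoin (pderiv u) Algebra.subset_adjoin ?_ (fun r => ?_) hf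
  · rintro _ ⟨w, -, rfl⟩
    rw [pderiv_X, Pi.single_apply]
    split_ifs
    exacts [one_mem _, zero_mem _]
  · rw [algebraMap_eq, pderiv_C]
    exact zero_mem _

theorem pderiv_eq_zero_of_mem_supported {u : σ} {S : Set σ} (hu : u ∉ S) {f : MvPolynomial σ R}
    (hf : f ∈ supported R S) : pderiv u f = 0 :=
  pderiv_eq_zero_of_notMem_vars fun h => hu (mem_supported.1 hf h)

theorem exists_ringHom_eqOn_supported_compl_singleton {Q : Type*} [CommRing Q]
    (π : MvPolynomial σ R →+* Q) (v : σ) (y : Q) :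
    ∃ ψ : MvPolynomial σ R →+* Q, ψ (X v) = y ∧ ∀ q ∈ supported R {v}ᶜ, ψ q = π q := by
  classical
  refine ⟨eval₂Hom (π.comp C) (Function.update (fun w => π (X w)) v y), by simp, fun q hq => ?_⟩
  refine hom_congr_vars (by ext; simp) (fun w hw _ => ?_) rfl
  have hwv : w ≠ v := mem_supported.1 hq hw
  simp [hwv]

end Polynomial

theorem finsupp_induction_add_single_one {ι : Type*} {P : (ι →₀ ℕ) → Prop} (zero : P 0)
    (add_single : ∀ θ j, P θ → P (θ + Finsupp.single j 1)) (θ : ι →₀ ℕ) : P θ := by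
  have add_single_nat (θ : ι →₀ ℕ) (j : ι) (b : ℕ) (h : P θ) : P (θ + Finsupp.single j b) := by
    induction b with
    | zero => simpa only [Finsupp.single_zero, add_zero] using h
    | succ b ih => rw [Finsupp.single_add, ← add_assoc]; exact add_single _ j ih
  exact Finsupp.induction₂ θ zero fun j b θ _ _ h => add_single_nat θ j b h

theorem foldr_iterate_add_single {ι α : Type*} {D : ι → α → α}
    (hD : ∀ i j, Function.Commute (D i) (D j)) (θ : ι →₀ ℕ) {j : ι} {l : List ι} (hl : l.Nodup)
    (hj : j ∈ l) (x : α) :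
    l.foldr (fun i => (D i)^[(θ + Finsupp.single j 1 : ι →₀ ℕ) i]) x =
      D j (l.foldr (fun i => (D i)^[θ i]) x) := by
  classical
  have apply_of_ne {i : ι} (hij : i ≠ j) : (θ + Finsupp.single j 1 : ι →₀ ℕ) i = θ i := by
    rw [Finsupp.add_apply, Finsupp.single_eq_of_ne hij, add_zero]
  induction l with
  | nil => simp at hj
  | cons i l ih =>
    rw [List.nodup_cons] at hl
    simp only [List.foldr_cons]
    by_cases hij : i = j
    · subst hij
      have htail : l.foldr (fun t => (D t)^[(θ + Finsupp.single i 1 : ι →₀ ℕ) t]) x =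
          l.foldr (fun t => (D t)^[θ t]) x :=
        List.foldr_ext _ _ _ fun t ht y => by rw [apply_of_ne (ne_of_mem_of_not_mem ht hl.1)]
      rw [htail, Finsupp.add_apply, Finsupp.single_eq_same, Function.iterate_succ_apply']
    · rw [ih hl.2 (List.mem_of_ne_of_mem (Ne.symm hij) hj), apply_of_ne hij]
      exact (hD i j).iterate_left _ _

namespace Deriv

variable {m n : ℕ}

theorem shift_zero (u : Deriv m n) : shift 0 u = u := by
  simp [shift]

theorem shift_shift (θ φ : Fin m →₀ ℕ) (u : Deriv m n) :
    shift θ (shift φ u) = shift (θ + φ) u := by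
  simp [shift, add_assoc]

theorem shift_add_single (θ : Fin m →₀ ℕ) (j : Fin m) (u : Deriv m n) :
    shift (θ + Finsupp.single j 1) u = shift (Finsupp.single j 1) (shift θ u) := by
  rw [shift_shift, add_comm]

theorem shift_injective (θ : Fin m →₀ ℕ) : Function.Injective (shift (n := n) θ) := by
  intro u v h
  simp only [shift, Deriv.mk.injEq, add_right_inj] at h
  exact Deriv.ext h.1 h.2

theorem shift_left_injective (u : Deriv m n) : Function.Injective fun θ => shift θ u := by
  intro θ φ h
  simpa [shift] using h

theorem shift_sup_tsub {u w : Deriv m n} :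
    shift (u.op ⊔ w.op - u.op) u = ⟨u.op ⊔ w.op, u.var⟩ :=
  Deriv.ext (tsub_add_cancel_of_le le_sup_left) rfl

theorem exists_eq_add_sup_tsub {u w : Deriv m n} {θ φ : Fin m →₀ ℕ} (h : shift θ u = shift φ w) :
    ∃ ψ, θ = ψ + (u.op ⊔ w.op - u.op) ∧ φ = ψ + (u.op ⊔ w.op - w.op) := by
  have hop : θ + u.op = φ + w.op := (Deriv.ext_iff.1 h).1
  have hle : u.op ⊔ w.op ≤ θ + u.op := sup_le le_add_self (hop ▸ le_add_self)
  have hψ := tsub_add_cancel_of_le hle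
  refine ⟨θ + u.op - u.op ⊔ w.op, add_right_cancel (b := u.op) ?_,
    add_right_cancel (b := w.op) ?_⟩
  · rw [add_assoc, tsub_add_cancel_of_le le_sup_left, hψ]
  · rw [add_assoc, tsub_add_cancel_of_le le_sup_right, hψ, hop]

end Deriv

namespace IsRanking

variable {m n : ℕ} [LinearOrder (Deriv m n)]

theorem shift_lt_shift (hrank : IsRanking m n) (θ : Fin m →₀ ℕ) {u v : Deriv m n} (h : u < v) :
    Deriv.shift θ u < Deriv.shift θ v :=
  (hrank.shift_mono θ v u h.le).lt_of_ne fun e => h.ne (Deriv.shift_injective θ e)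

theorem lt_shift (hrank : IsRanking m n) {θ : Fin m →₀ ℕ} (hθ : θ ≠ 0) (u : Deriv m n) :
    u < Deriv.shift θ u := by
  refine (hrank.le_shift θ u).lt_of_ne fun e => hθ ?_
  exact Deriv.shift_left_injective u (e.symm.trans (Deriv.shift_zero u).symm)

theorem lt_shift_single (hrank : IsRanking m n) (j : Fin m) (u : Deriv m n) :
    u < Deriv.shift (Finsupp.single j 1) u :=
  hrank.lt_shift (Finsupp.single_ne_zero.2 one_ne_zero) u

/-- Dickson's lemma forbids infinite descending chains. -/
theorem wellFoundedLT (hrank : IsRanking m n) : WellFoundedLT (Deriv m n) := by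
  have hwqo : WellQuasiOrdered fun a b : Fin n × (Fin m →₀ ℕ) => a.1 = b.1 ∧ a.2 ≤ b.2 :=
    (Finite.wellQuasiOrdered (· = ·)).prod wellQuasiOrdered_le
  rw [WellFoundedLT, isWellFounded_iff, RelEmbedding.wellFounded_iff_isEmpty]
  refine ⟨fun s => ?_⟩
  obtain ⟨i, j, hij, hvar, hop⟩ := hwqo fun i => ((s i).var, (s i).op)
  have hlt : s j < s i := s.map_rel_iff.2 hij
  have hshift : s j = Deriv.shift ((s j).op - (s i).op) (s i) :=
    Deriv.ext (tsub_add_cancel_of_le hop).symm hvar.symm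
  exact absurd (hrank.le_shift ((s j).op - (s i).op) (s i)) (not_le.2 (hshift ▸ hlt))

end IsRanking

namespace DiffPoly

section Saturation

variable {R : Type*} [CommRing R]

theorem le_sat (I : Ideal R) (S : Set R) : I ≤ sat I S :=
  fun a ha => ⟨1, one_mem _, by rwa [one_mul]⟩

theorem sat_le_sat {I J : Ideal R} {S : Set R} (h : I ≤ sat J S) : sat I S ≤ sat J S := by
  rintro a ⟨s, hs, hsa⟩
  obtain ⟨t, ht, htsa⟩ := h hsa
  exact ⟨t * s, mul_mem ht hs, by rwa [mul_assoc]⟩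

theorem sat_mono {I J : Ideal R} (S : Set R) (h : I ≤ J) : sat I S ≤ sat J S :=
  sat_le_sat (h.trans (le_sat J S))

theorem mem_sat_of_mul_mem {I : Ideal R} {S : Set R} {s a : R} (hs : s ∈ Submonoid.closure S)
    (h : s * a ∈ sat I S) : a ∈ sat I S :=
  sat_le_sat le_rfl ⟨s, hs, h⟩

theorem derivation_mem_sat {R₀ : Type*} [CommRing R₀] [Algebra R₀ R] (D : Derivation R₀ R R)
    {I J : Ideal R} (hIJ : I ≤ J) (hD : ∀ x ∈ I, D x ∈ J) {S : Set R} {a : R}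
    (ha : a ∈ sat I S) : D a ∈ sat J S := by
  obtain ⟨s, hs, hsa⟩ := ha
  refine ⟨s * s, mul_mem hs hs, ?_⟩
  have h : s * s * D a = s * D (s * a) - D s * (s * a) := by
    rw [D.leibniz, smul_eq_mul, smul_eq_mul]
    ring
  rw [h]
  exact J.sub_mem (J.mul_mem_left _ (hD _ hsa)) (J.mul_mem_left _ (hIJ hsa))

/-- The canonical map from `R` to the quotient of the localization `S⁻¹R` by the extension of `I`.
Its kernel is `I : S^∞`, so that membership in `I : S^∞` can be tested in a ring where the elements
of `S` are invertible. -/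
noncomputable abbrev satMap (I : Ideal R) (S : Set R) :
    R →+* Localization (Submonoid.closure S) ⧸
      I.map (algebraMap R (Localization (Submonoid.closure S))) :=
  (Ideal.Quotient.mk _).comp (algebraMap R _)

theorem satMap_eq_zero_iff {I : Ideal R} {S : Set R} {a : R} :
    satMap I S a = 0 ↔ a ∈ sat I S := by
  rw [RingHom.comp_apply, Ideal.Quotient.eq_zero_iff_mem,
    IsLocalization.algebraMap_mem_map_algebraMap_iff (Submonoid.closure S)]
  rfl

theorem isUnit_satMap (I : Ideal R) {S : Set R} {s : R} (hs : s ∈ Submonoid.closure S) :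
    IsUnit (satMap I S s) :=
  (IsLocalization.map_units _ (⟨s, hs⟩ : Submonoid.closure S)).map (Ideal.Quotient.mk _)

theorem mem_sat_span_of_mem_sat_span_insert {σ : Type*} {v : σ} {G H : Set (MvPolynomial σ R)}
    (hG : G ⊆ supported R {v}ᶜ) (hH : H ⊆ supported R {v}ᶜ) {s q p : MvPolynomial σ R}
    (hs : s ∈ Submonoid.closure H) (hq : q - s * X v ∈ supported R {v}ᶜ)
    (hp : p ∈ supported R {v}ᶜ) (h : p ∈ sat (Ideal.span (insert q G)) H) :
    p ∈ sat (Ideal.span G) H := by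
  set π := satMap (Ideal.span G) H
  have hclosure : ∀ t ∈ Submonoid.closure H, t ∈ supported R {v}ᶜ := fun t ht =>
    (Submonoid.closure_le (S := (supported R {v}ᶜ).toSubmonoid)).2 hH ht
  obtain ⟨y, hy⟩ : π s ∣ -π (q - s * X v) := (isUnit_satMap _ hs).dvd
  obtain ⟨ψ, hψv, hψ⟩ := exists_ringHom_eqOn_supported_compl_singleton π v y
  have hψq : ψ q = 0 := calc
    ψ q = ψ (q - s * X v) + ψ s * ψ (X v) := by rw [← map_mul, ← map_add, sub_add_cancel]
    _ = π (q - s * X v) + π s * y := by rw [hψ _ hq, hψ s (hclosure s hs), hψv]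
    _ = 0 := by rw [← hy, add_neg_cancel]
  have hker : Ideal.span (insert q G) ≤ RingHom.ker ψ := by
    refine Ideal.span_le.2 (Set.insert_subset hψq fun g hg => ?_)
    exact (hψ g (hG hg)).trans (satMap_eq_zero_iff.2 (le_sat _ _ (Ideal.subset_span hg)))
  obtain ⟨t, ht, htp⟩ := h
  have hπtp : π t * π p = 0 := by
    rw [← hψ t (hclosure t ht), ← hψ p hp, ← map_mul]
    exact hker htp
  exact satMap_eq_zero_iff.1 ((isUnit_satMap _ ht).mul_right_eq_zero.1 hπtp)

end Saturation

variable {m n : ℕ} {k : Type*} [Field k]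

section Derivations

variable (δ : Fin m → Derivation ℤ k k)

theorem mapCoeff_C (d : Derivation ℤ k k) (a : k) :
    mapCoeff d (C a : DiffPoly m n k) = C (d a) := by
  classical
  ext s
  rw [coeff_mapCoeff, coeff_C, coeff_C]
  split_ifs <;> simp

theorem mapCoeff_X (d : Derivation ℤ k k) (u : Deriv m n) :
    mapCoeff d (X u : DiffPoly m n k) = 0 := by
  classical
  ext s
  rw [coeff_mapCoeff, coeff_X, coeff_zero]
  split_ifs <;> simp

theorem deriv_C (j : Fin m) (a : k) : deriv δ j (C a : DiffPoly m n k) = C (δ j a) := by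
  change mapCoeff (δ j) (C a) + mkDerivation k _ (C a) = _
  rw [mapCoeff_C, derivation_C, add_zero]

theorem deriv_X (j : Fin m) (u : Deriv m n) :
    deriv δ j (X u : DiffPoly m n k) = X (Deriv.shift (Finsupp.single j 1) u) := by
  change mapCoeff (δ j) (X u) + mkDerivation k _ (X u) = _
  rw [mapCoeff_X, mkDerivation_X, zero_add]

theorem deriv_comm (hδ : ∀ i j a, δ i (δ j a) = δ j (δ i a)) (i j : Fin m)
    (f : DiffPoly m n k) : deriv δ i (deriv δ j f) = deriv δ j (deriv δ i f) := by
  induction f using MvPolynomial.induction_on with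
  | C a => simp only [deriv_C, hδ i j]
  | add f g hf hg => simp only [map_add, hf, hg]
  | mul_X f u hf =>
    simp only [Derivation.leibniz, smul_eq_mul, deriv_X, map_add, hf, Deriv.shift_shift,
      add_comm (Finsupp.single i 1)]
    ring

theorem applyOp_zero (f : DiffPoly m n k) : applyOp δ 0 f = f := by
  simp [applyOp]

theorem applyOp_add_single (hδ : ∀ i j a, δ i (δ j a) = δ j (δ i a)) (θ : Fin m →₀ ℕ)
    (j : Fin m) (f : DiffPoly m n k) :
    applyOp δ (θ + Finsupp.single j 1) f = deriv δ j (applyOp δ θ f) :=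
  foldr_iterate_add_single (deriv_comm δ hδ) θ (List.nodup_finRange m) (List.mem_finRange j) f

theorem span_le_diffIdeal (F : Set (DiffPoly m n k)) : Ideal.span F ≤ diffIdeal δ F :=
  le_sInf fun _ hI => Ideal.span_le.2 hI.1

theorem deriv_mem_supported (j : Fin m) {S T : Set (Deriv m n)} (hST : S ⊆ T)
    (hshift : ∀ u ∈ S, Deriv.shift (Finsupp.single j 1) u ∈ T) {f : DiffPoly m n k}
    (hf : f ∈ supported k S) : deriv δ j f ∈ supported k T := by
  refine derivation_mem_of_mem_adjoin (deriv δ j)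
    (Algebra.subset_adjoin.trans (supported_mono hST)) ?_ (fun a => ?_) hf
  · rintro _ ⟨u, hu, rfl⟩
    rw [deriv_X]
    exact X_mem_supported.2 (hshift u hu)
  · rw [algebraMap_eq, deriv_C]
    exact Subalgebra.algebraMap_mem _ _

theorem coeffIn_mem_supported (u : Deriv m n) (d : ℕ) {S : Set (Deriv m n)}
    {f : DiffPoly m n k} (hf : f ∈ supported k S) : coeffIn u d f ∈ supported k S := by
  classical
  refine sum_mem fun s hs => ?_
  have hsf : s ∈ f.support := (Finset.mem_filter.1 hs).1
  rw [mem_supported, vars_monomial (mem_support_iff.1 hsf), Finsupp.support_erase]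
  exact fun w hw => mem_supported_iff_forall_mem_support.1 hf s hsf (Finset.mem_of_mem_erase hw)

variable [LinearOrder (Deriv m n)]

theorem applyOp_mem_supported_Iic (hδ : ∀ i j a, δ i (δ j a) = δ j (δ i a))
    (hrank : IsRanking m n) {u : Deriv m n} {f : DiffPoly m n k}
    (hf : f ∈ supported k (Set.Iic u)) (θ : Fin m →₀ ℕ) :
    applyOp δ θ f ∈ supported k (Set.Iic (Deriv.shift θ u)) := by
  induction θ using finsupp_induction_add_single_one with
  | zero => rwa [applyOp_zero, Deriv.shift_zero]
  | add_single θ j ih =>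
    rw [applyOp_add_single δ hδ, Deriv.shift_add_single]
    exact deriv_mem_supported δ j (Set.Iic_subset_Iic.2 (hrank.le_shift _ _))
      (fun w hw => hrank.shift_mono _ (Deriv.shift θ u) w hw) ih

theorem deriv_sub_pderiv_mul_X_mem_supported (hrank : IsRanking m n) (j : Fin m) {u : Deriv m n}
    {f : DiffPoly m n k} (hf : f ∈ supported k (Set.Iic u)) :
    deriv δ j f - pderiv u f * X (Deriv.shift (Finsupp.single j 1) u) ∈
      supported k (Set.Iio (Deriv.shift (Finsupp.single j 1) u)) := by
  let v := Deriv.shift (Finsupp.single j 1) u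
  let D : Derivation ℤ (DiffPoly m n k) (DiffPoly m n k) :=
    deriv δ j - (X v : DiffPoly m n k) • (pderiv u).restrictScalars ℤ
  have hD (q : DiffPoly m n k) : D q = deriv δ j q - pderiv u q * X v := by
    rw [Derivation.sub_apply, Derivation.smul_apply, Derivation.restrictScalars_apply, smul_eq_mul,
      mul_comm]
  have hle : supported k (Set.Iic u) ≤ supported k (Set.Iio v) :=
    supported_mono fun w hw => lt_of_le_of_lt hw (hrank.lt_shift_single j u)
  rw [← hD]
  refine derivation_mem_of_mem_adjoin D (Algebra.subset_adjoin.trans hle) ?_ (fun a => ?_) hf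
  · rintro _ ⟨w, hw, rfl⟩
    rw [hD, deriv_X]
    rcases (show w ≤ u from hw).eq_or_lt with rfl | hwu
    · rw [pderiv_X_self, one_mul, sub_self]
      exact zero_mem _
    · rw [pderiv_X_of_ne hwu.ne, zero_mul, sub_zero]
      exact X_mem_supported.2 (hrank.shift_lt_shift _ hwu)
  · rw [hD, algebraMap_eq, deriv_C, pderiv_C, zero_mul, sub_zero]
    exact Subalgebra.algebraMap_mem _ _

theorem pderiv_shift_deriv (hrank : IsRanking m n) (j : Fin m) {u : Deriv m n}
    {f : DiffPoly m n k} (hf : f ∈ supported k (Set.Iic u)) :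
    pderiv (Deriv.shift (Finsupp.single j 1) u) (deriv δ j f) = pderiv u f := by
  set v := Deriv.shift (Finsupp.single j 1) u
  have hlower : pderiv v (deriv δ j f - pderiv u f * X v) = 0 :=
    pderiv_eq_zero_of_mem_supported Set.self_notMem_Iio
      (deriv_sub_pderiv_mul_X_mem_supported δ hrank j hf)
  have hsep : pderiv v (pderiv u f) = 0 :=
    pderiv_eq_zero_of_mem_supported (Set.notMem_Iic.2 (hrank.lt_shift_single j u))
      (pderiv_mem_supported u hf)
  rw [map_sub, Derivation.leibniz, hsep, pderiv_X_self, smul_zero, add_zero, smul_eq_mul, mul_one]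
    at hlower
  exact sub_eq_zero.1 hlower

theorem pderiv_shift_applyOp (hδ : ∀ i j a, δ i (δ j a) = δ j (δ i a)) (hrank : IsRanking m n)
    {u : Deriv m n} {f : DiffPoly m n k} (hf : f ∈ supported k (Set.Iic u)) (θ : Fin m →₀ ℕ) :
    pderiv (Deriv.shift θ u) (applyOp δ θ f) = pderiv u f := by
  induction θ using finsupp_induction_add_single_one with
  | zero => rw [applyOp_zero, Deriv.shift_zero]
  | add_single θ j ih =>
    rw [applyOp_add_single δ hδ, Deriv.shift_add_single,
      pderiv_shift_deriv δ hrank j (applyOp_mem_supported_Iic δ hδ hrank hf θ), ih]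

theorem applyOp_sub_pderiv_mul_X_mem_supported (hδ : ∀ i j a, δ i (δ j a) = δ j (δ i a))
    (hrank : IsRanking m n) {u : Deriv m n} {f : DiffPoly m n k}
    (hf : f ∈ supported k (Set.Iic u)) {θ : Fin m →₀ ℕ} (hθ : θ ≠ 0) :
    applyOp δ θ f - pderiv u f * X (Deriv.shift θ u) ∈ supported k (Set.Iio (Deriv.shift θ u)) := by
  obtain ⟨j, hj⟩ := Finsupp.ne_iff.1 hθ
  obtain ⟨φ, rfl⟩ : ∃ φ, θ = φ + Finsupp.single j 1 :=
    ⟨_, (Finsupp.sub_add_single_one_cancel hj).symm⟩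
  rw [applyOp_add_single δ hδ, Deriv.shift_add_single, ← pderiv_shift_applyOp δ hδ hrank hf φ]
  exact deriv_sub_pderiv_mul_X_mem_supported δ hrank j (applyOp_mem_supported_Iic δ hδ hrank hf φ)

end Derivations

section Leaders

variable [LinearOrder (Deriv m n)] {C : Set (DiffPoly m n k)}

theorem IsLeader.mem_supported_Iic {u : Deriv m n} {f : DiffPoly m n k} (h : IsLeader u f) :
    f ∈ supported k (Set.Iic u) :=
  mem_supported.2 fun w hw => h.2 w hw

theorem IsLeader.unique {u w : Deriv m n} {f : DiffPoly m n k} (hu : IsLeader u f)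
    (hw : IsLeader w f) : u = w :=
  le_antisymm (hw.2 u hu.1) (hu.2 w hw.1)

theorem IsDTriangular.exists_isLeader (hC : IsDTriangular C) {f : DiffPoly m n k} (hf : f ∈ C) :
    ∃ u, IsLeader u f := by
  have hne : f.vars.Nonempty :=
    Finset.nonempty_iff_ne_empty.2 fun h => hC.not_const f hf _ (vars_eq_empty_iff_eq_C.1 h)
  exact ⟨f.vars.max' hne, f.vars.max'_mem hne, f.vars.le_max'⟩

theorem separantAt_mem_closure_initSep {u : Deriv m n} {f : DiffPoly m n k} (hf : f ∈ C)
    (hu : IsLeader u f) : separantAt u f ∈ Submonoid.closure (initSep C) :=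
  Submonoid.subset_closure ⟨f, hf, u, hu, Or.inr rfl⟩

theorem initSep_subset_supported {S : Set (Deriv m n)} (hS : C ⊆ supported k S) :
    initSep C ⊆ supported k S := by
  rintro _ ⟨f, hf, u, -, rfl | rfl⟩
  exacts [coeffIn_mem_supported _ _ (hS hf), pderiv_mem_supported _ (hS hf)]

theorem closure_initSep_subset_supported {S : Set (Deriv m n)} (hS : C ⊆ supported k S) :
    (Submonoid.closure (initSep C) : Set (DiffPoly m n k)) ⊆ supported k S :=
  (Submonoid.closure_le (S := (supported k S).toSubmonoid)).2 (initSep_subset_supported hS)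

/-- The derivatives that are not proper derivatives of leaders of elements of `C`. A polynomial is
partially reduced with respect to every element of `C` when it involves only these. -/
def partiallyReducedVars (C : Set (DiffPoly m n k)) : Set (Deriv m n) :=
  {w | ∀ c ∈ C, ∀ u, IsLeader u c → ¬ w.IsProperDerivOf u}

theorem mem_supported_partiallyReducedVars_iff {f : DiffPoly m n k} :
    f ∈ supported k (partiallyReducedVars C) ↔ ∀ c ∈ C, PartiallyReduced f c := by
  rw [mem_supported]
  exact ⟨fun h c hc u hu w hw => h hw c hc u hu, fun h w hw c hc u hu => h c hc u hu w hw⟩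

theorem partiallyReduced_self (hrank : IsRanking m n) (f : DiffPoly m n k) :
    PartiallyReduced f f := by
  rintro u hu _ hw ⟨θ, hθ, rfl⟩
  exact (hrank.lt_shift hθ u).not_ge (hu.2 _ hw)

theorem IsDTriangular.subset_supported_partiallyReducedVars (hrank : IsRanking m n)
    (hC : IsDTriangular C) : C ⊆ supported k (partiallyReducedVars C) := by
  refine fun f hf => mem_supported_partiallyReducedVars_iff.2 fun c hc => ?_
  by_cases hfc : f = c
  · exact hfc ▸ partiallyReduced_self hrank f
  · exact hC.partially f hf c hc hfc

end Leaders

section Coherence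

variable [LinearOrder (Deriv m n)] {δ : Fin m → Derivation ℤ k k} {C : Set (DiffPoly m n k)}

theorem deriv_mem_sat_prolongBelow (hδ : ∀ i j a, δ i (δ j a) = δ j (δ i a))
    (hrank : IsRanking m n) (j : Fin m) {v : Deriv m n} {H : Set (DiffPoly m n k)}
    {a : DiffPoly m n k} (ha : a ∈ sat (Ideal.span (prolongBelow δ C v)) H) :
    deriv δ j a ∈
      sat (Ideal.span (prolongBelow δ C (Deriv.shift (Finsupp.single j 1) v))) H := by
  have hsub : prolongBelow δ C v ⊆ prolongBelow δ C (Deriv.shift (Finsupp.single j 1) v) :=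
    fun _ ⟨c, hc, u, θ, hu, hlt, hq⟩ => ⟨c, hc, u, θ, hu, hlt.trans_le (hrank.le_shift _ _), hq⟩
  refine derivation_mem_sat _ (Ideal.span_mono hsub) (fun x hx => ?_) ha
  refine derivation_mem_of_mem_span _ (hsub.trans Ideal.subset_span) ?_ hx
  rintro _ ⟨c, hc, u, θ, hu, hlt, rfl⟩
  refine Ideal.subset_span ⟨c, hc, u, θ + Finsupp.single j 1, hu, ?_,
    (applyOp_add_single δ hδ θ j c).symm⟩
  rw [Deriv.shift_add_single]
  exact hrank.shift_lt_shift _ hlt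

theorem cross_sub_mem_sat_add_single (hδ : ∀ i j a, δ i (δ j a) = δ j (δ i a))
    (hrank : IsRanking m n) {f g : DiffPoly m n k} (hf : f ∈ C) (hg : g ∈ C) {u w : Deriv m n}
    (hu : IsLeader u f) (hw : IsLeader w g) {θ φ : Fin m →₀ ℕ}
    (heq : Deriv.shift θ u = Deriv.shift φ w) {a b : DiffPoly m n k} {H : Set (DiffPoly m n k)}
    (h : a * applyOp δ θ f - b * applyOp δ φ g ∈
      sat (Ideal.span (prolongBelow δ C (Deriv.shift θ u))) H) (j : Fin m) :
    a * applyOp δ (θ + Finsupp.single j 1) f - b * applyOp δ (φ + Finsupp.single j 1) g ∈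
      sat (Ideal.span (prolongBelow δ C (Deriv.shift (θ + Finsupp.single j 1) u))) H := by
  rw [applyOp_add_single δ hδ, applyOp_add_single δ hδ, Deriv.shift_add_single]
  have hlt := hrank.lt_shift_single j (Deriv.shift θ u)
  refine mul_derivation_sub_mul_derivation_mem (deriv δ j) ?_ ?_
    (deriv_mem_sat_prolongBelow hδ hrank j h)
  · exact le_sat _ _ (Ideal.subset_span ⟨f, hf, u, θ, hu, hlt, rfl⟩)
  · exact le_sat _ _ (Ideal.subset_span ⟨g, hg, w, φ, hw, heq ▸ hlt, rfl⟩)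

/-- Differentiating the relation at the lowest common derivative of two leaders gives the relations
at all the other ones. -/
theorem IsCoherent.sub_mem_sat (hδ : ∀ i j a, δ i (δ j a) = δ j (δ i a))
    (hrank : IsRanking m n) (hcoh : IsCoherent δ C) {f g : DiffPoly m n k} (hf : f ∈ C)
    (hg : g ∈ C) {u w : Deriv m n} (hu : IsLeader u f) (hw : IsLeader w g)
    {θ φ : Fin m →₀ ℕ} (h : Deriv.shift θ u = Deriv.shift φ w) :
    separantAt w g * applyOp δ θ f - separantAt u f * applyOp δ φ g ∈
      sat (Ideal.span (prolongBelow δ C (Deriv.shift θ u))) (initSep C) := by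
  by_cases hfg : f = g
  · subst hfg
    obtain rfl := hu.unique hw
    obtain rfl := Deriv.shift_left_injective u h
    rw [sub_self]
    exact zero_mem _
  have hvar : u.var = w.var := (Deriv.ext_iff.1 h).2
  have hsup : Deriv.shift (u.op ⊔ w.op - u.op) u = Deriv.shift (u.op ⊔ w.op - w.op) w := by
    rw [Deriv.shift_sup_tsub, sup_comm, Deriv.shift_sup_tsub, hvar]
  obtain ⟨ψ, rfl, rfl⟩ := Deriv.exists_eq_add_sup_tsub h
  clear h
  induction ψ using finsupp_induction_add_single_one with
  | zero =>
    rw [zero_add, zero_add, Deriv.shift_sup_tsub]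
    exact hcoh f hf g hg hfg u w hu hw hvar
  | add_single ψ j ih =>
    rw [add_right_comm ψ _ (u.op ⊔ w.op - u.op), add_right_comm ψ _ (u.op ⊔ w.op - w.op)]
    refine cross_sub_mem_sat_add_single hδ hrank hf hg hu hw ?_ ih j
    rw [← Deriv.shift_shift, ← Deriv.shift_shift, hsup]

end Coherence

section Rosenfeld

variable [LinearOrder (Deriv m n)] {δ : Fin m → Derivation ℤ k k} {C : Set (DiffPoly m n k)}

/-- The elements of `C` that have a leader, together with their prolongations `θ f` whose leader
`θ (ld f)` belongs to `S`. The elements of `C` are included whatever their leaders, so that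
eliminating derivatives from `S` leads down to `(C)`. -/
def prolong (δ : Fin m → Derivation ℤ k k) (C : Set (DiffPoly m n k)) (S : Set (Deriv m n)) :
    Set (DiffPoly m n k) :=
  {q | ∃ f ∈ C, ∃ u θ, IsLeader u f ∧ (θ = 0 ∨ Deriv.shift θ u ∈ S) ∧ q = applyOp δ θ f}

theorem prolong_mono : Monotone (prolong δ C) :=
  fun _ _ h _ ⟨f, hf, u, θ, hu, hS, hq⟩ => ⟨f, hf, u, θ, hu, hS.imp_right (h ·), hq⟩

theorem prolong_empty_subset : prolong δ C ∅ ⊆ C := by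
  rintro _ ⟨f, hf, u, θ, -, rfl | ⟨⟨⟩⟩, rfl⟩
  rwa [applyOp_zero]

theorem prolongBelow_subset_prolong_Iio (v : Deriv m n) :
    prolongBelow δ C v ⊆ prolong δ C (Set.Iio v) :=
  fun _ ⟨f, hf, u, θ, hu, hlt, hq⟩ => ⟨f, hf, u, θ, hu, Or.inr hlt, hq⟩

theorem prolong_subset_supported (hδ : ∀ i j a, δ i (δ j a) = δ j (δ i a))
    (hrank : IsRanking m n) {v : Deriv m n} (hC : C ⊆ supported k {v}ᶜ) :
    prolong δ C (Set.Iio v) ⊆ supported k {v}ᶜ := by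
  rintro _ ⟨f, hf, u, θ, hu, rfl | hlt, rfl⟩
  · rw [applyOp_zero]
    exact hC hf
  · refine supported_mono ?_ (applyOp_mem_supported_Iic δ hδ hrank hu.mem_supported_Iic θ)
    exact fun w hw => ne_of_lt (lt_of_le_of_lt hw hlt)

theorem diffIdeal_le_span_prolong_univ (hδ : ∀ i j a, δ i (δ j a) = δ j (δ i a))
    (hC : IsDTriangular C) : diffIdeal δ C ≤ Ideal.span (prolong δ C Set.univ) := by
  refine sInf_le ⟨fun f hf => ?_, fun j f hf => ?_⟩
  · obtain ⟨u, hu⟩ := hC.exists_isLeader hf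
    exact Ideal.subset_span ⟨f, hf, u, 0, hu, Or.inl rfl, (applyOp_zero δ f).symm⟩
  · refine derivation_mem_of_mem_span (deriv δ j) Ideal.subset_span ?_ hf
    rintro _ ⟨c, hc, u, θ, hu, -, rfl⟩
    exact Ideal.subset_span ⟨c, hc, u, _, hu, Or.inr trivial, (applyOp_add_single δ hδ θ j c).symm⟩

theorem exists_mem_span_prolong_Iic {S : Set (Deriv m n)} (hS : S.Nonempty) {p : DiffPoly m n k}
    (hp : p ∈ Ideal.span (prolong δ C S)) :
    ∃ v ∈ S, p ∈ Ideal.span (prolong δ C (Set.Iic v)) := by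
  have := hS.to_subtype
  have hmono : Monotone fun v : S => Ideal.span (prolong δ C (Set.Iic (v : Deriv m n))) :=
    fun v w hvw => Ideal.span_mono (prolong_mono (Set.Iic_subset_Iic.2 hvw))
  have hle : Ideal.span (prolong δ C S) ≤
      ⨆ v : S, Ideal.span (prolong δ C (Set.Iic (v : Deriv m n))) := by
    refine Ideal.span_le.2 ?_
    rintro q ⟨f, hf, u, θ, hu, hθ | hθS, rfl⟩
    · exact Ideal.mem_iSup_of_mem (Classical.arbitrary S)
        (Ideal.subset_span ⟨f, hf, u, θ, hu, Or.inl hθ, rfl⟩)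
    · exact Ideal.mem_iSup_of_mem ⟨_, hθS⟩
        (Ideal.subset_span ⟨f, hf, u, θ, hu, Or.inr Set.self_mem_Iic, rfl⟩)
  obtain ⟨v, hv⟩ := (Submodule.mem_iSup_of_directed _ hmono.directed_le).1 (hle hp)
  exact ⟨v, v.2, hv⟩

theorem prolong_Iic_subset_prolong_Iio {v : Deriv m n} (hv : v ∈ partiallyReducedVars C) :
    prolong δ C (Set.Iic v) ⊆ prolong δ C (Set.Iio v) := by
  rintro _ ⟨f, hf, u, θ, hu, hθ, rfl⟩
  refine ⟨f, hf, u, θ, hu, or_iff_not_imp_left.2 fun hθ0 => ?_, rfl⟩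
  exact (hθ.resolve_left hθ0).lt_of_ne fun heq => hv f hf u hu ⟨θ, hθ0, heq.symm⟩

theorem IsCoherent.span_prolong_Iic_le (hδ : ∀ i j a, δ i (δ j a) = δ j (δ i a))
    (hrank : IsRanking m n) (hcoh : IsCoherent δ C) {c : DiffPoly m n k} (hc : c ∈ C)
    {u : Deriv m n} (hu : IsLeader u c) (θ : Fin m →₀ ℕ) :
    Ideal.span (prolong δ C (Set.Iic (Deriv.shift θ u))) ≤
      sat (Ideal.span (insert (applyOp δ θ c) (prolong δ C (Set.Iio (Deriv.shift θ u)))))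
        (initSep C) := by
  set v := Deriv.shift θ u
  set J := Ideal.span (insert (applyOp δ θ c) (prolong δ C (Set.Iio v)))
  have hlower : prolong δ C (Set.Iio v) ⊆ J := (Set.subset_insert _ _).trans Ideal.subset_span
  refine Ideal.span_le.2 ?_
  rintro _ ⟨f, hf, w, φ, hw, hφ, rfl⟩
  by_cases hlt : φ = 0 ∨ Deriv.shift φ w < v
  · exact le_sat _ _ (hlower ⟨f, hf, w, φ, hw, hlt, rfl⟩)
  have heq : Deriv.shift φ w = v := by
    rw [not_or] at hlt
    exact (hφ.resolve_left hlt.1).eq_of_not_lt hlt.2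
  have hcross : separantAt u c * applyOp δ φ f - separantAt w f * applyOp δ θ c ∈
      sat J (initSep C) := by
    refine sat_mono _ (Ideal.span_le.2 ?_) (hcoh.sub_mem_sat hδ hrank hf hc hw hu heq)
    exact heq ▸ (prolongBelow_subset_prolong_Iio v).trans hlower
  have hθc : applyOp δ θ c ∈ sat J (initSep C) :=
    le_sat _ _ (Ideal.subset_span (Set.mem_insert _ _))
  refine mem_sat_of_mul_mem (separantAt_mem_closure_initSep hc hu) ?_
  simpa only [sub_add_cancel] using add_mem hcross (Ideal.mul_mem_left _ (separantAt w f) hθc)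

theorem IsCoherent.mem_sat_prolong_Iio (hδ : ∀ i j a, δ i (δ j a) = δ j (δ i a))
    (hrank : IsRanking m n) (hC : IsDTriangular C) (hcoh : IsCoherent δ C) {v : Deriv m n}
    {p : DiffPoly m n k} (hp : p ∈ supported k (partiallyReducedVars C))
    (h : p ∈ sat (Ideal.span (prolong δ C (Set.Iic v))) (initSep C)) :
    p ∈ sat (Ideal.span (prolong δ C (Set.Iio v))) (initSep C) := by
  by_cases hv : v ∈ partiallyReducedVars C
  · exact sat_mono _ (Ideal.span_mono (prolong_Iic_subset_prolong_Iio hv)) h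
  have hfree : supported k (partiallyReducedVars C) ≤ supported k {v}ᶜ :=
    supported_mono (Set.subset_compl_singleton_iff.2 hv)
  have hCv : C ⊆ supported k {v}ᶜ := (hC.subset_supported_partiallyReducedVars hrank).trans hfree
  obtain ⟨c, hc, u, hu, θ, hθ, rfl⟩ : ∃ c ∈ C, ∃ u, IsLeader u c ∧ v.IsProperDerivOf u := by
    simpa [partiallyReducedVars] using hv
  have hlinear := supported_mono (fun w => ne_of_lt)
    (applyOp_sub_pderiv_mul_X_mem_supported δ hδ hrank hu.mem_supported_Iic hθ)
  exact mem_sat_span_of_mem_sat_span_insert (prolong_subset_supported hδ hrank hCv)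
    (initSep_subset_supported hCv) (separantAt_mem_closure_initSep hc hu) hlinear (hfree hp)
    (sat_le_sat (hcoh.span_prolong_Iic_le hδ hrank hc hu θ) h)

theorem mem_sat_span_or_exists_mem_sat_prolong_Iic {S : Set (Deriv m n)} {p : DiffPoly m n k}
    {H : Set (DiffPoly m n k)} (h : p ∈ sat (Ideal.span (prolong δ C S)) H) :
    p ∈ sat (Ideal.span C) H ∨ ∃ v ∈ S, p ∈ sat (Ideal.span (prolong δ C (Set.Iic v))) H := by
  rcases S.eq_empty_or_nonempty with rfl | hS
  · exact Or.inl (sat_mono _ (Ideal.span_mono prolong_empty_subset) h)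
  · obtain ⟨s, hs, hsp⟩ := h
    obtain ⟨v, hv, hvp⟩ := exists_mem_span_prolong_Iic hS hsp
    exact Or.inr ⟨v, hv, s, hs, hvp⟩

/-- **Rosenfeld's lemma**. -/
theorem IsCoherent.mem_sat_span_of_mem_sat_diffIdeal (hδ : ∀ i j a, δ i (δ j a) = δ j (δ i a))
    (hrank : IsRanking m n) (hC : IsDTriangular C) (hcoh : IsCoherent δ C)
    {p : DiffPoly m n k} (hp : p ∈ supported k (partiallyReducedVars C))
    (h : p ∈ sat (diffIdeal δ C) (initSep C)) : p ∈ sat (Ideal.span C) (initSep C) := by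
  have := hrank.wellFoundedLT
  have descend (v : Deriv m n) : p ∈ sat (Ideal.span (prolong δ C (Set.Iic v))) (initSep C) →
      p ∈ sat (Ideal.span C) (initSep C) := by
    induction v using WellFoundedLT.induction with
    | ind v ih =>
      intro hv
      rcases mem_sat_span_or_exists_mem_sat_prolong_Iic
        (hcoh.mem_sat_prolong_Iio hδ hrank hC hp hv) with hspan | ⟨w, hw, hwp⟩
      exacts [hspan, ih w hw hwp]
  rcases mem_sat_span_or_exists_mem_sat_prolong_Iic
    (sat_mono _ (diffIdeal_le_span_prolong_univ hδ hC) h) with hspan | ⟨v, -, hv⟩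
  exacts [hspan, descend v hv]

end Rosenfeld

section Restriction

variable {P : Set (Deriv m n)}

theorem restrictTo_eq_aeval (P : Set (Deriv m n)) (f : DiffPoly m n k) :
    restrictTo P f = aeval (P.indicator X) f := by
  classical
  rw [restrictTo, Finset.sum_filter, aeval_def, eval₂_eq]
  refine Finset.sum_congr rfl fun s _ => ?_
  split_ifs with hs
  · rw [monomial_eq, algebraMap_eq, Finsupp.prod]
    exact congrArg _ (Finset.prod_congr rfl fun u hu => by rw [Set.indicator_of_mem (hs hu)])
  · obtain ⟨u, hu, huP⟩ := Set.not_subset.1 hs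
    rw [Finset.prod_eq_zero hu, mul_zero]
    rw [Set.indicator_of_notMem huP, zero_pow (Finsupp.mem_support_iff.1 hu)]

theorem restrictTo_sub (P : Set (Deriv m n)) (f g : DiffPoly m n k) :
    restrictTo P (f - g) = restrictTo P f - restrictTo P g := by
  simp only [restrictTo_eq_aeval, map_sub]

theorem restrictTo_mul (P : Set (Deriv m n)) (f g : DiffPoly m n k) :
    restrictTo P (f * g) = restrictTo P f * restrictTo P g := by
  simp only [restrictTo_eq_aeval, map_mul]

theorem restrictTo_of_mem_supported {f : DiffPoly m n k} (hf : f ∈ supported k P) :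
    restrictTo P f = f := by
  classical
  rw [restrictTo, Finset.filter_true_of_mem (mem_supported_iff_forall_mem_support.1 hf),
    support_sum_monomial_coeff]

theorem restrictTo_compl_singleton_sum {u : Deriv m n} {N : ℕ} {a : ℕ → DiffPoly m n k}
    (ha : u ∉ (a 0).vars) :
    restrictTo {u}ᶜ (∑ i ∈ Finset.range (N + 1), a i * X u ^ i) = a 0 := by
  have hX : aeval (Set.indicator {u}ᶜ X) (X u : DiffPoly m n k) = (0 : DiffPoly m n k) := by
    simp
  have ha0 : a 0 ∈ supported k {u}ᶜ := mem_supported.2 (Set.subset_compl_singleton_iff.2 ha)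
  rw [restrictTo_eq_aeval, map_sum, Finset.sum_range_succ', Finset.sum_eq_zero, zero_add, pow_zero,
    mul_one, ← restrictTo_eq_aeval, restrictTo_of_mem_supported ha0]
  intro i _
  rw [map_mul, map_pow, hX, zero_pow i.succ_ne_zero, mul_zero]

theorem support_restrictTo_subset (P : Set (Deriv m n)) (f : DiffPoly m n k) :
    (restrictTo P f).support ⊆ f.support := by
  classical
  exact (support_sum_monomial_subset _ _).trans (Finset.filter_subset _ _)

theorem restrictTo_mem_supported (P : Set (Deriv m n)) (f : DiffPoly m n k) :
    restrictTo P f ∈ supported k P := by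
  classical
  exact mem_supported_iff_forall_mem_support.2 fun _ hs =>
    (Finset.mem_filter.1 (support_sum_monomial_subset _ _ hs)).2

theorem restrictTo_mem_span {F : Set (DiffPoly m n k)} (hF : F ⊆ supported k P)
    {a : DiffPoly m n k} (ha : a ∈ Ideal.span F) : restrictTo P a ∈ Ideal.span F := by
  have hle : Ideal.span F ≤ (Ideal.span F).comap (aeval (R := k) (P.indicator X)) := by
    refine Ideal.span_le.2 fun f hf => ?_
    rw [SetLike.mem_coe, Ideal.mem_comap, ← restrictTo_eq_aeval,
      restrictTo_of_mem_supported (hF hf)]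
    exact Ideal.subset_span hf
  rw [restrictTo_eq_aeval]
  exact hle ha

theorem subset_supported_iff_derivativesIn_subset {F : Set (DiffPoly m n k)} :
    F ⊆ supported k P ↔ derivativesIn F ⊆ P :=
  ⟨fun h _ ⟨_, hf, hu⟩ => mem_supported.1 (h hf) hu,
    fun h f hf => mem_supported.2 fun _ hu => h ⟨f, hf, hu⟩⟩

theorem forall_maxOrder_le_iff {F : Set (DiffPoly m n k)} {p : Fin n → ℕ} :
    (∀ i, maxOrder i F ≤ p i) ↔ F ⊆ supported k {u : Deriv m n | u.ord ≤ p u.var} := by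
  simp only [maxOrder, iSup_le_iff, Nat.cast_le]
  refine ⟨fun h f hf => mem_supported.2 fun u hu => h _ f hf u hu rfl, ?_⟩
  rintro h _ f hf u hu rfl
  exact mem_supported.1 (h hf) hu

end Restriction

section Remainders

variable [LinearOrder (Deriv m n)] {δ : Fin m → Derivation ℤ k k} {C : Set (DiffPoly m n k)}
  {P : Set (Deriv m n)} {f g g' : DiffPoly m n k}

theorem Reduced.of_support_subset (h : Reduced f g) (hsupp : g'.support ⊆ f.support) :
    Reduced g' g := by
  refine ⟨fun u hu v hv => h.1 u hu v ?_, fun u hu => lt_of_le_of_lt ?_ (h.2 u hu)⟩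
  · obtain ⟨s, hs, hvs⟩ := (mem_vars_iff_mem_support v).1 hv
    exact (mem_vars_iff_mem_support v).2 ⟨s, hsupp hs, hvs⟩
  · classical
    rw [degreeOf_eq_sup, degreeOf_eq_sup]
    exact Finset.sup_mono hsupp

theorem restrictTo_mem_sat (hC : C ⊆ supported k P)
    (h : f ∈ sat (Ideal.span C) (initSep C)) :
    restrictTo P f ∈ sat (Ideal.span C) (initSep C) := by
  obtain ⟨s, hs, hsf⟩ := h
  refine ⟨s, hs, ?_⟩
  rw [← restrictTo_of_mem_supported (closure_initSep_subset_supported hC hs), ← restrictTo_mul]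
  exact restrictTo_mem_span hC hsf

theorem IsDiffRemainder.mem_supported_partiallyReducedVars (hg : IsDiffRemainder δ C f g) :
    g ∈ supported k (partiallyReducedVars C) :=
  mem_supported_partiallyReducedVars_iff.2 fun c hc => (hg.1 c hc).1

theorem IsDiffRemainder.of_sub_mem_sat (hg : IsDiffRemainder δ C f g)
    (hred : ∀ c ∈ C, Reduced g' c) (h : g - g' ∈ sat (diffIdeal δ C) (initSep C)) :
    IsDiffRemainder δ C f g' := by
  obtain ⟨s, hs, hsf⟩ := hg.2
  exact ⟨hred, s, hs, sub_add_sub_cancel (s * f) g g' ▸ add_mem hsf h⟩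

theorem IsDiffRemainder.exists_mul_sub_mul_mem_sat (hδ : ∀ i j a, δ i (δ j a) = δ j (δ i a))
    (hrank : IsRanking m n) (hC : IsDTriangular C) (hcoh : IsCoherent δ C)
    (hg : IsDiffRemainder δ C f g) (hg' : IsDiffRemainder δ C f g') :
    ∃ h ∈ Submonoid.closure (initSep C), ∃ h' ∈ Submonoid.closure (initSep C),
      h * g' - h' * g ∈ sat (Ideal.span C) (initSep C) := by
  obtain ⟨h, hh, hfg⟩ := hg.2
  obtain ⟨h', hh', hfg'⟩ := hg'.2
  have hfree := closure_initSep_subset_supported (hC.subset_supported_partiallyReducedVars hrank)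
  refine ⟨h, hh, h', hh', hcoh.mem_sat_span_of_mem_sat_diffIdeal hδ hrank hC ?_ ?_⟩
  · exact sub_mem (mul_mem (hfree hh) hg'.mem_supported_partiallyReducedVars)
      (mul_mem (hfree hh') hg.mem_supported_partiallyReducedVars)
  · have hcross : h * g' - h' * g = h' * (h * f - g) - h * (h' * f - g') := by ring
    rw [hcross]
    exact sub_mem (Ideal.mul_mem_left _ _ hfg) (Ideal.mul_mem_left _ _ hfg')

theorem IsDiffRemainder.sub_restrictTo_mem_sat (hδ : ∀ i j a, δ i (δ j a) = δ j (δ i a))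
    (hrank : IsRanking m n) (hC : IsDTriangular C) (hcoh : IsCoherent δ C)
    (hg : IsDiffRemainder δ C f g) (hg' : IsDiffRemainder δ C f g')
    (hP : C ∪ {g} ⊆ supported k P) :
    g' - restrictTo P g' ∈ sat (Ideal.span C) (initSep C) := by
  obtain ⟨hCP, hgP⟩ := Set.union_subset_iff.1 hP
  obtain ⟨h, hh, h', hh', hmem⟩ := hg.exists_mul_sub_mul_mem_sat hδ hrank hC hcoh hg'
  have hfix := closure_initSep_subset_supported hCP
  have hrestrict : restrictTo P (h * g' - h' * g) = h * restrictTo P g' - h' * g := by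
    rw [restrictTo_sub, restrictTo_mul, restrictTo_mul, restrictTo_of_mem_supported (hfix hh),
      restrictTo_of_mem_supported (hfix hh'), restrictTo_of_mem_supported (hgP rfl)]
  have hdiff : h * (g' - restrictTo P g') =
      (h * g' - h' * g) - restrictTo P (h * g' - h' * g) := by
    rw [hrestrict]
    ring
  refine mem_sat_of_mul_mem hh ?_
  rw [hdiff]
  exact sub_mem hmem (restrictTo_mem_sat hCP hmem)

theorem IsDiffRemainder.sub_restrictTo_mem_sat_and_isDiffRemainder
    (hδ : ∀ i j a, δ i (δ j a) = δ j (δ i a)) (hrank : IsRanking m n) (hC : IsDTriangular C)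
    (hcoh : IsCoherent δ C) (hg : IsDiffRemainder δ C f g) (hg' : IsDiffRemainder δ C f g')
    (hP : C ∪ {g} ⊆ supported k P) :
    g' - restrictTo P g' ∈ sat (Ideal.span C) (initSep C) ∧
      IsDiffRemainder δ C f (restrictTo P g') := by
  have hmem := hg.sub_restrictTo_mem_sat hδ hrank hC hcoh hg' hP
  exact ⟨hmem, hg'.of_sub_mem_sat
    (fun c hc => (hg'.1 c hc).of_support_subset (support_restrictTo_subset P g'))
    (sat_mono _ (span_le_diffIdeal δ C) hmem)⟩

end Remainders

end DiffPoly

theorem mainTheorem5_general {m n : ℕ} {k : Type*} [Field k]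
    (δ : Fin m → Derivation ℤ k k) (hδ : ∀ i j a, δ i (δ j a) = δ j (δ i a))
    [LinearOrder (Deriv m n)] (hrank : IsRanking m n)
    (C : Set (DiffPoly m n k)) (hC : DiffPoly.IsDTriangular C)
    (hcoh : DiffPoly.IsCoherent δ C) (f : DiffPoly m n k) :
    (∀ g g' : DiffPoly m n k,
      DiffPoly.IsDiffRemainder δ C f g → DiffPoly.IsDiffRemainder δ C f g' →
      ∀ u ∉ DiffPoly.derivativesIn (C ∪ {g}), ∀ (N : ℕ) (a : ℕ → DiffPoly m n k),
        (∀ i ≤ N, u ∉ (a i).vars) →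
        g' = ∑ i ∈ Finset.range (N + 1), a i * MvPolynomial.X u ^ i →
        g' - a 0 ∈ DiffPoly.sat (Ideal.span C) (DiffPoly.initSep C) ∧
          DiffPoly.IsDiffRemainder δ C f (a 0)) ∧
    (∀ g g' : DiffPoly m n k,
      DiffPoly.IsDiffRemainder δ C f g → DiffPoly.IsDiffRemainder δ C f g' →
      g' - DiffPoly.restrictTo (DiffPoly.derivativesIn (C ∪ {g})) g' ∈
          DiffPoly.sat (Ideal.span C) (DiffPoly.initSep C) ∧
        DiffPoly.IsDiffRemainder δ C f
          (DiffPoly.restrictTo (DiffPoly.derivativesIn (C ∪ {g})) g')) ∧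
    (∀ p : Fin n → ℕ, (∀ i, DiffPoly.maxOrder i C ≤ p i) →
      (∃ g, DiffPoly.IsDiffRemainder δ C f g ∧ ∀ i, DiffPoly.maxOrder i {g} ≤ p i) →
      ∀ g, DiffPoly.IsDiffRemainder δ C f g →
        DiffPoly.IsDiffRemainder δ C f (DiffPoly.truncate p g) ∧
          ∀ i, DiffPoly.maxOrder i {DiffPoly.truncate p g} ≤ p i) := by
  have restrict {g g' : DiffPoly m n k} {P : Set (Deriv m n)}
      (hg : DiffPoly.IsDiffRemainder δ C f g) (hg' : DiffPoly.IsDiffRemainder δ C f g') :=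
    hg.sub_restrictTo_mem_sat_and_isDiffRemainder (P := P) hδ hrank hC hcoh hg'
  refine ⟨fun g g' hg hg' u hu N a ha hsum => ?_, fun g g' hg hg' => ?_,
    fun p hCp ⟨g₀, hg₀, hg₀p⟩ g hg => ⟨?_, ?_⟩⟩
  · have ha0 : DiffPoly.restrictTo {u}ᶜ g' = a 0 :=
      hsum ▸ DiffPoly.restrictTo_compl_singleton_sum (ha 0 N.zero_le)
    exact ha0 ▸ restrict hg hg' (DiffPoly.subset_supported_iff_derivativesIn_subset.2
      (Set.subset_compl_singleton_iff.2 hu))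
  · exact restrict hg hg' (DiffPoly.subset_supported_iff_derivativesIn_subset.2 subset_rfl)
  · exact (restrict hg₀ hg (Set.union_subset (DiffPoly.forall_maxOrder_le_iff.1 hCp)
      (DiffPoly.forall_maxOrder_le_iff.1 hg₀p))).2
  · exact DiffPoly.forall_maxOrder_le_iff.2
      (Set.singleton_subset_iff.2 (DiffPoly.restrictTo_mem_supported _ g))

theorem mainTheorem5 {m n : ℕ} {k : Type*} [Field k] [CharZero k]
    (δ : Fin m → Derivation ℤ k k) (hδ : ∀ i j a, δ i (δ j a) = δ j (δ i a))
    [LinearOrder (Deriv m n)] (hrank : IsRanking m n)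
    (C : Set (DiffPoly m n k)) (hC : DiffPoly.IsDTriangular C)
    (hcoh : DiffPoly.IsCoherent δ C) (f : DiffPoly m n k) :
    -- two remainders, a single derivative `u` that is not present in `C` and `g`
    (∀ g g' : DiffPoly m n k,
      DiffPoly.IsDiffRemainder δ C f g → DiffPoly.IsDiffRemainder δ C f g' →
      ∀ u ∉ DiffPoly.derivativesIn (C ∪ {g}), ∀ (N : ℕ) (a : ℕ → DiffPoly m n k),
        (∀ i ≤ N, u ∉ (a i).vars) →
        g' = ∑ i ∈ Finset.range (N + 1), a i * MvPolynomial.X u ^ i →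
        g' - a 0 ∈ DiffPoly.sat (Ideal.span C) (DiffPoly.initSep C) ∧
          DiffPoly.IsDiffRemainder δ C f (a 0)) ∧
    -- two remainders, all the derivatives that are not present in `C` and `g`
    (∀ g g' : DiffPoly m n k,
      DiffPoly.IsDiffRemainder δ C f g → DiffPoly.IsDiffRemainder δ C f g' →
      g' - DiffPoly.restrictTo (DiffPoly.derivativesIn (C ∪ {g})) g' ∈
          DiffPoly.sat (Ideal.span C) (DiffPoly.initSep C) ∧
        DiffPoly.IsDiffRemainder δ C f
          (DiffPoly.restrictTo (DiffPoly.derivativesIn (C ∪ {g})) g')) ∧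
    -- truncation
    (∀ p : Fin n → ℕ, (∀ i, DiffPoly.maxOrder i C ≤ p i) →
      (∃ g, DiffPoly.IsDiffRemainder δ C f g ∧ ∀ i, DiffPoly.maxOrder i {g} ≤ p i) →
      ∀ g, DiffPoly.IsDiffRemainder δ C f g →
        DiffPoly.IsDiffRemainder δ C f (DiffPoly.truncate p g) ∧
          ∀ i, DiffPoly.maxOrder i {DiffPoly.truncate p g} ≤ p i) :=
  mainTheorem5_general δ hδ hrank C hC hcoh f
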